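/- All graphs are finite and simple. The join $G_1\vee G_2$ of two graphs is obtained from their disjoint union $G_1\cup G_2$ by joining every vertex of $G_1$ to every vertex of $G_2$; $K_m$ is the complete graph on $m$ vertices and $mK_1$ is the edgeless graph on $m$ vertices. The spectral radius $\rho(G)$ is the largest eigenvalue of the adjacency matrix of $G$. A graph $G$ is called $1$-excludable if, for every edge $e$ of $G$, the graph $G$ has a perfect matching that does not contain $e$. Theorem 1.6. Let $n$ be an even positive integer and let $G$ be a connected graph on $n$ vertices with minimum degree at least $2$. (i) If $n=6$ and $\rho(G)\ge\rho(K_2\vee(K_2\cup 2K_1))$, then $G$ is $1$-excludable if and only if $G$ is not isomorphic to $K_2\vee(K_2\cup 2K_1)$. (ii) If $n=8$ and $\rho(G)\ge\rho(K_3\vee(K_2\cup 3K_1))$, then $G$ is $1$-excludable if and only if $G$ is not isomorphic to $K_3\vee(K_2\cup 3K_1)$. (iii) If $n\ge 10$ and $\rho(G)\ge\rho(K_1\vee(K_2\cup K_{n-3}))$, then $G$ is $1$-excludable if and only if $G$ is not isomorphic to $K_1\vee(K_2\cup K_{n-3})$. -/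

import Mathlib

/-- The join `G ∨ H`: the disjoint union of `G` and `H` together with all edges between a vertex
of `G` and a vertex of `H`. -/
def SimpleGraph.joinWith {V W : Type*} (G : SimpleGraph V) (H : SimpleGraph W) :
    SimpleGraph (V ⊕ W) :=
  (G ⊕g H) ⊔ completeBipartiteGraph V W

open Classical in
/-- The (adjacency) spectral radius of a finite graph: the largest eigenvalue of its real
adjacency matrix. (The spectrum of a real square matrix is its finite set of real eigenvalues,
and it is non-empty for a symmetric matrix of positive order.) -/
noncomputable def SimpleGraph.adjSpectralRadius {V : Type*} [Fintype V] (G : SimpleGraph V) : ℝ :=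
  sSup (spectrum ℝ (G.adjMatrix ℝ))

/-- A graph is 1-excludable if for every edge `e` it has a perfect matching not containing `e`. -/
def SimpleGraph.IsOneExcludable {V : Type*} (G : SimpleGraph V) : Prop :=
  ∀ e ∈ G.edgeSet, ∃ M : G.Subgraph, M.IsPerfectMatching ∧ e ∉ M.edgeSet

/-- The graph `K_a ∨ (K_b ∪ c K_1)`. -/
def cliqueJoinCliqueIsolated (a b c : ℕ) : SimpleGraph (Fin a ⊕ (Fin b ⊕ Fin c)) :=
  (SimpleGraph.completeGraph (Fin a)).joinWith (SimpleGraph.completeGraph (Fin b) ⊕g SimpleGraph.emptyGraph (Fin c))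

/-- The graph `K_a ∨ (K_b ∪ K_c)`. -/
def cliqueJoinTwoCliques (a b c : ℕ) : SimpleGraph (Fin a ⊕ (Fin b ⊕ Fin c)) :=
  (SimpleGraph.completeGraph (Fin a)).joinWith (SimpleGraph.completeGraph (Fin b) ⊕g SimpleGraph.completeGraph (Fin c))

/-! If G is not 1-excludable, some edge pq lies in every perfect matching, so G − pq has none. By
Tutte and parity, some set S of size s leaves at least s + 2 odd components in G − pq
(`exists_splitBy_of_isMatchingFree`). A singleton component has G-degree at most s + 1, and at most
s unless it is an end of pq. As degrees are at least 2, singletons are impossible for s = 0 and are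
ends of pq for s = 1. Hence G has few edges, or lies in K_1 ∨ (K_2 ∪ K_{n-3}), or s ≥ 2 and the edge
count is bounded in terms of s, with G inside K_s ∨ (K_2 ∪ sK_1) when n = 2s + 2
(`exists_of_not_isOneExcludable`).

Conversely, minimum degree d gives ρ² − (d−1)ρ ≤ 2m − d(n−1), m being the number of edges
(`adjSpectralRadius_sq_sub_le_of_minDegree`), so a large ρ forces many edges. The two estimates
leave the extremal graph and a few competitors with n = 8 or 10, which are removed by test vectors
or by a sharper degree count. The extremal graphs themselves fail by a Hall-type obstruction
(`not_isOneExcludable_of_iso`). -/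

namespace SimpleGraph
open Finset

/-! ### Bounds for the spectral radius from test vectors and from degrees. -/

section Spectral

lemma isHermitian_adjMatrix_real {V : Type*} (G : SimpleGraph V) [DecidableRel G.Adj] :
    (G.adjMatrix ℝ).IsHermitian := by
  rw [Matrix.IsHermitian, Matrix.conjTranspose_eq_transpose_of_trivial]
  exact G.isSymm_adjMatrix

lemma sum_mul_sum_neighborFinset_comm {V : Type*} [Fintype V] (G : SimpleGraph V)
    [DecidableRel G.Adj] (x z : V → ℝ) :
    ∑ v, x v * ∑ u ∈ G.neighborFinset v, z u = ∑ v, (∑ u ∈ G.neighborFinset v, x u) * z v := by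
  simp only [Finset.mul_sum, Finset.sum_mul]
  exact Finset.sum_comm' fun v u => by simp [adj_comm]

variable {V : Type*} [Fintype V] [DecidableEq V] (G : SimpleGraph V) [DecidableRel G.Adj]

lemma adjSpectralRadius_eq : G.adjSpectralRadius = sSup (spectrum ℝ (G.adjMatrix ℝ)) := by
  unfold adjSpectralRadius
  congr!

lemma le_adjSpectralRadius_of_mem_spectrum {μ : ℝ} (h : μ ∈ spectrum ℝ (G.adjMatrix ℝ)) :
    μ ≤ G.adjSpectralRadius := by
  rw [adjSpectralRadius_eq]
  refine le_csSup ?_ h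
  rw [G.isHermitian_adjMatrix_real.spectrum_real_eq_range_eigenvalues]
  exact (Set.finite_range _).bddAbove

lemma adjSpectralRadius_mem_spectrum [Nonempty V] :
    G.adjSpectralRadius ∈ spectrum ℝ (G.adjMatrix ℝ) := by
  rw [adjSpectralRadius_eq]
  rw [G.isHermitian_adjMatrix_real.spectrum_real_eq_range_eigenvalues]
  exact (Set.range_nonempty _).csSup_mem (Set.finite_range _)

lemma posSemidef_adjSpectralRadius_sub :
    (algebraMap ℝ (Matrix V V ℝ) G.adjSpectralRadius - G.adjMatrix ℝ).PosSemidef := by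
  rw [Matrix.posSemidef_iff_isHermitian_and_spectrum_nonneg]
  constructor
  · refine Matrix.IsHermitian.sub ?_ G.isHermitian_adjMatrix_real
    rw [Matrix.IsHermitian, Matrix.conjTranspose_eq_transpose_of_trivial]
    simp [Matrix.algebraMap_eq_diagonal]
  · intro x hx
    rw [← spectrum.singleton_sub_eq] at hx
    obtain ⟨a, rfl, b, hb, rfl⟩ := hx
    simpa using G.le_adjSpectralRadius_of_mem_spectrum hb

lemma adjSpectralRadius_sub_mulVec (x : V → ℝ) (v : V) :
    ((algebraMap ℝ (Matrix V V ℝ) G.adjSpectralRadius - G.adjMatrix ℝ).mulVec x) v =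
      G.adjSpectralRadius * x v - ∑ u ∈ G.neighborFinset v, x u := by
  rw [Matrix.sub_mulVec, Pi.sub_apply, adjMatrix_mulVec_apply, Algebra.algebraMap_eq_smul_one,
    Matrix.smul_mulVec, Matrix.one_mulVec, Pi.smul_apply, smul_eq_mul]

/-- The Rayleigh bound for the adjacency matrix. -/
lemma sum_mul_sum_neighborFinset_le (x : V → ℝ) :
    ∑ v, x v * ∑ u ∈ G.neighborFinset v, x u ≤ G.adjSpectralRadius * ∑ v, x v ^ 2 := by
  have h := G.posSemidef_adjSpectralRadius_sub.dotProduct_mulVec_nonneg x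
  simp only [dotProduct, adjSpectralRadius_sub_mulVec, mul_sub, Finset.sum_sub_distrib,
    Pi.star_apply, star_trivial] at h
  rw [Finset.mul_sum]
  have e : ∑ v, x v * (G.adjSpectralRadius * x v) = ∑ v, G.adjSpectralRadius * x v ^ 2 :=
    Finset.sum_congr rfl fun v _ => by ring
  linarith

/-- A nonnegative eigenvector for the spectral radius. -/
lemma exists_nonneg_eigenvector [Nonempty V] :
    ∃ z : V → ℝ, (∀ v, 0 ≤ z v) ∧ 0 < ∑ v, z v ∧
      ∀ v, ∑ u ∈ G.neighborFinset v, z u = G.adjSpectralRadius * z v := by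
  obtain ⟨y, hy0, hy⟩ : ∃ y : V → ℝ, y ≠ 0 ∧
      (algebraMap ℝ (Matrix V V ℝ) G.adjSpectralRadius - G.adjMatrix ℝ).mulVec y = 0 := by
    have h := G.adjSpectralRadius_mem_spectrum
    rw [spectrum.mem_iff, Matrix.isUnit_iff_isUnit_det, isUnit_iff_ne_zero, not_not] at h
    exact Matrix.exists_mulVec_eq_zero_iff.2 h
  have hy' : ∀ v, ∑ u ∈ G.neighborFinset v, y u = G.adjSpectralRadius * y v := fun v => by
    have := congrFun hy v
    rw [adjSpectralRadius_sub_mulVec, Pi.zero_apply] at this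
    linarith
  -- ρI − A is positive semidefinite, so its kernel is the zero set of its quadratic form, and
  -- replacing y by |y| cannot increase that form. Connectedness plays no role.
  have hz : (algebraMap ℝ (Matrix V V ℝ) G.adjSpectralRadius - G.adjMatrix ℝ).mulVec
      (fun v => |y v|) = 0 := by
    rw [← G.posSemidef_adjSpectralRadius_sub.dotProduct_mulVec_zero_iff]
    refine le_antisymm ?_ (G.posSemidef_adjSpectralRadius_sub.dotProduct_mulVec_nonneg _)
    simp only [dotProduct, adjSpectralRadius_sub_mulVec, Pi.star_apply, star_trivial]
    refine Finset.sum_nonpos fun v _ => ?_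
    have h1 : G.adjSpectralRadius * |y v| * |y v| ≤ |y v| * ∑ u ∈ G.neighborFinset v, |y u| := by
      calc G.adjSpectralRadius * |y v| * |y v|
          = (G.adjSpectralRadius * y v) * y v := by rw [mul_assoc, abs_mul_abs_self, mul_assoc]
        _ ≤ |(G.adjSpectralRadius * y v) * y v| := le_abs_self _
        _ = |y v| * |∑ u ∈ G.neighborFinset v, y u| := by rw [hy', abs_mul, mul_comm]
        _ ≤ _ := by gcongr; exact Finset.abs_sum_le_sum_abs _ _
    linarith
  refine ⟨fun v => |y v|, fun v => abs_nonneg _, ?_, fun v => ?_⟩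
  · obtain ⟨v, hv⟩ := Function.ne_iff.1 hy0
    exact Finset.sum_pos' (fun v _ => abs_nonneg _) ⟨v, mem_univ _, abs_pos.2 hv⟩
  · have := congrFun hz v
    rw [adjSpectralRadius_sub_mulVec, Pi.zero_apply] at this
    linarith

/-- Pair x with a nonnegative eigenvector z: ρ⟨x, z⟩ = ⟨Ax, z⟩ ≤ l⟨x, z⟩, and ⟨x, z⟩ > 0 because x
is positive everywhere. -/
lemma adjSpectralRadius_le_of_weights [Nonempty V] {l : ℝ} (x : V → ℝ) (hx : ∀ v, 0 < x v)
    (h : ∀ v, ∑ u ∈ G.neighborFinset v, x u ≤ l * x v) : G.adjSpectralRadius ≤ l := by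
  obtain ⟨z, hz0, hz1, hz⟩ := G.exists_nonneg_eigenvector
  have h1 := G.sum_mul_sum_neighborFinset_comm x z
  simp only [hz] at h1
  have hpos : 0 < ∑ v, x v * z v := by
    obtain ⟨v, -, hv⟩ := Finset.exists_lt_of_sum_lt (s := univ) (f := fun _ => (0 : ℝ)) (g := z)
      (by simpa using hz1)
    exact Finset.sum_pos' (fun v _ => mul_nonneg (hx v).le (hz0 v))
      ⟨v, mem_univ _, mul_pos (hx v) hv⟩
  have h2 : G.adjSpectralRadius * ∑ v, x v * z v ≤ l * ∑ v, x v * z v := by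
    calc _ = ∑ v, x v * (G.adjSpectralRadius * z v) := by
            rw [Finset.mul_sum]; exact Finset.sum_congr rfl fun v _ => by ring
      _ = ∑ v, (∑ u ∈ G.neighborFinset v, x u) * z v := h1
      _ ≤ ∑ v, (l * x v) * z v := by gcongr with v; exacts [hz0 v, h v]
      _ = _ := by rw [Finset.mul_sum]; exact Finset.sum_congr rfl fun v _ => by ring
  exact le_of_mul_le_mul_right h2 hpos

/-- The hypothesis bounds the row sums of A² − kA. Pairing the all-ones vector with a nonnegative
eigenvector turns this into a bound on ρ² − kρ. -/
lemma adjSpectralRadius_sq_sub_le [Nonempty V] {k R : ℝ}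
    (h : ∀ v, ∑ u ∈ G.neighborFinset v, (G.degree u : ℝ) - k * G.degree v ≤ R) :
    G.adjSpectralRadius ^ 2 - k * G.adjSpectralRadius ≤ R := by
  obtain ⟨z, hz0, hz1, hz⟩ := G.exists_nonneg_eigenvector
  have h1 := G.sum_mul_sum_neighborFinset_comm (fun _ => 1) z
  have h2 := G.sum_mul_sum_neighborFinset_comm (fun v => G.degree v) z
  simp only [hz, one_mul, Finset.sum_const, card_neighborFinset_eq_degree, nsmul_eq_mul,
    mul_one] at h1 h2
  have h3 : (G.adjSpectralRadius ^ 2 - k * G.adjSpectralRadius) * ∑ v, z v ≤ R * ∑ v, z v := by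
    calc _ = G.adjSpectralRadius * (∑ v, G.adjSpectralRadius * z v) -
              k * ∑ v, G.adjSpectralRadius * z v := by rw [← Finset.mul_sum]; ring
      _ = ∑ v, (∑ u ∈ G.neighborFinset v, (G.degree u : ℝ)) * z v
            - k * ∑ v, G.degree v * z v := by
          rw [h1, ← h2, Finset.mul_sum]
          congr 1
          exact Finset.sum_congr rfl fun v _ => by ring
      _ = ∑ v, (∑ u ∈ G.neighborFinset v, (G.degree u : ℝ) - k * G.degree v) * z v := by
          rw [Finset.mul_sum, ← Finset.sum_sub_distrib]
          exact Finset.sum_congr rfl fun v _ => by ring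
      _ ≤ ∑ v, R * z v := by gcongr with v; exacts [hz0 v, h v]
      _ = _ := by rw [Finset.mul_sum]
  exact le_of_mul_le_mul_right h3 hz1

lemma le_adjSpectralRadius_of_weights [Nonempty V] {l : ℝ} (x : V → ℝ) (hx : ∀ v, 0 < x v)
    (h : ∀ v, l * x v ≤ ∑ u ∈ G.neighborFinset v, x u) : l ≤ G.adjSpectralRadius := by
  have h1 := G.sum_mul_sum_neighborFinset_le x
  have h2 : l * ∑ v, x v ^ 2 ≤ G.adjSpectralRadius * ∑ v, x v ^ 2 := by
    refine le_trans ?_ h1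
    rw [Finset.mul_sum]
    refine Finset.sum_le_sum fun v _ => ?_
    have := mul_le_mul_of_nonneg_left (h v) (hx v).le
    linarith
  exact le_of_mul_le_mul_right h2
    (Finset.sum_pos (fun v _ => pow_pos (hx v) 2) univ_nonempty)

/-- Compare the degrees of the vertices outside the closed neighbourhood of `v` with `d`, allowing
a total deficit of `t`. -/
lemma sum_neighborFinset_degree_le {d t : ℕ} (v : V)
    (h : d * #(univ \ insert v (G.neighborFinset v)) ≤
      ∑ u ∈ univ \ insert v (G.neighborFinset v), G.degree u + t) :
    ∑ u ∈ G.neighborFinset v, (G.degree u : ℝ) - (d - 1) * G.degree v ≤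
      2 * #G.edgeFinset - d * (Fintype.card V - 1) + t := by
  have h1 := G.sum_degrees_eq_twice_card_edges
  have h2 := Finset.sum_sdiff (f := fun u => G.degree u)
    (Finset.subset_univ (insert v (G.neighborFinset v)))
  rw [Finset.sum_insert (by simp), h1] at h2
  have h3 := Finset.card_sdiff_add_card_eq_card
    (Finset.subset_univ (insert v (G.neighborFinset v)))
  rw [Finset.card_insert_of_notMem (by simp), card_neighborFinset_eq_degree, card_univ] at h3
  rify at h h2 h3
  rw [← h3]
  nlinarith

lemma adjSpectralRadius_sq_sub_le_of_minDegree [Nonempty V] {d : ℕ} (hd : ∀ v, d ≤ G.degree v) :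
    G.adjSpectralRadius ^ 2 - (d - 1) * G.adjSpectralRadius ≤
      2 * #G.edgeFinset - d * (Fintype.card V - 1) := by
  refine G.adjSpectralRadius_sq_sub_le fun v => ?_
  have := G.sum_neighborFinset_degree_le (d := d) (t := 0) v (by
    rw [add_zero, mul_comm, ← smul_eq_mul]
    exact Finset.card_nsmul_le_sum _ _ _ fun u _ => hd u)
  simpa using this

end Spectral

/-! ### Tutte's obstruction as a vertex colouring, and the resulting edge counts. -/

section Splitting
variable {V κ : Type*}

/-- Outside `S`, adjacent vertices of `H` have the same colour under `c`. -/
def SplitBy (H : SimpleGraph V) (S : Finset V) (c : V → κ) : Prop :=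
  ∀ x ∉ S, ∀ y ∉ S, H.Adj x y → c x = c y

/-- Tutte's theorem for graphs of even order, with the parity of the number of odd components
taken into account. -/
lemma exists_splitBy_of_isMatchingFree.{u} {V : Type u} [Fintype V] [DecidableEq V]
    (H : SimpleGraph V) (hV : Even (Fintype.card V)) (hH : H.IsMatchingFree) :
    ∃ (κ : Type u) (_ : DecidableEq κ) (S : Finset V) (c : V → κ) (O : Finset κ),
      H.SplitBy S c ∧ #S + 2 ≤ #O ∧ ∀ i ∈ O, Odd #{v ∈ Sᶜ | c v = i} := by
  classical
  obtain ⟨u, hu⟩ := exists_isTutteViolator hH (by simpa [Nat.card_eq_fintype_card] using hV)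
  set D := ((⊤ : H.Subgraph).deleteVerts u).coe with hD
  have hmem : ∀ v, v ∈ ((⊤ : H.Subgraph).deleteVerts u).verts ↔ v ∉ u.toFinset := by simp
  let c : V → Option D.ConnectedComponent := fun v =>
    if h : v ∈ ((⊤ : H.Subgraph).deleteVerts u).verts then some (D.connectedComponentMk ⟨v, h⟩)
    else none
  have hcard : #u.toFinset = u.ncard := (Set.ncard_eq_toFinset_card' u).symm
  have hOcard : #(D.oddComponents.toFinset.image some) = D.oddComponents.ncard := by
    rw [Finset.card_image_of_injective _ (Option.some_injective _), Set.ncard_eq_toFinset_card']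
  refine ⟨Option D.ConnectedComponent, inferInstance, u.toFinset, c,
    D.oddComponents.toFinset.image some, ?_, ?_, ?_⟩
  · intro x hx y hy hxy
    have hx' := (hmem x).2 hx
    have hy' := (hmem y).2 hy
    simp only [c, dif_pos hx', dif_pos hy']
    congr 1
    refine ConnectedComponent.sound (Adj.reachable ?_)
    simp only [hD, Subgraph.coe_adj, Subgraph.deleteVerts_adj]
    simp_all
  · have hlt : u.ncard < D.oddComponents.ncard := hu
    -- The number of odd components has the parity of n − |u|, hence of |u|, so exceeding |u| means
    -- exceeding it by at least 2.
    have hpar : Odd D.oddComponents.ncard ↔ Odd (Nat.card _) := D.odd_ncard_oddComponents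
    have hn : Nat.card ((⊤ : H.Subgraph).deleteVerts u).verts + u.ncard = Fintype.card V := by
      have : ((⊤ : H.Subgraph).deleteVerts u).verts = uᶜ := by ext; simp
      rw [Nat.card_coe_set_eq, this, add_comm, Set.ncard_add_ncard_compl,
        Nat.card_eq_fintype_card]
    rw [hcard, hOcard]
    by_contra hlt'
    have h1 : D.oddComponents.ncard = u.ncard + 1 := by omega
    rw [← hn, Nat.even_add] at hV
    rw [h1, Nat.odd_add_one, ← Nat.not_even_iff_odd, ← Nat.not_even_iff_odd] at hpar
    tauto
  · intro i hi
    obtain ⟨K, hK, rfl⟩ := Finset.mem_image.1 hi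
    have hK' : Odd K.supp.ncard := by simpa using hK
    have : ((({v ∈ u.toFinsetᶜ | c v = some K} : Finset V)) : Set V) = Subtype.val '' K.supp := by
      ext v
      simp only [coe_filter, Finset.mem_compl, Set.mem_ofPred_eq, Set.mem_image,
        ConnectedComponent.mem_supp_iff, Subtype.exists, exists_and_right, exists_eq_right]
      constructor
      · rintro ⟨h1, h2⟩
        have h1' := (hmem v).2 h1
        simp only [c, dif_pos h1', Option.some.injEq] at h2
        exact ⟨h1', h2⟩
      · rintro ⟨h1, h2⟩
        refine ⟨(hmem v).1 h1, ?_⟩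
        simp only [c, dif_pos h1, h2]
    rwa [← Set.ncard_coe_finset, this, Set.ncard_image_of_injective _ Subtype.val_injective]

lemma card_image_add_card_fiber_le {V κ : Type*} [DecidableEq κ] (T : Finset V) (c : V → κ) {i : κ} (hi : i ∈ T.image c) :
    #(T.image c) + #{w ∈ T | c w = i} ≤ #T + 1 := by
  have h1 := Finset.card_filter_add_card_filter_not (s := T) (fun w => c w = i)
  have h2 : #((T.image c).erase i) ≤ #{w ∈ T | ¬ c w = i} := by
    refine le_trans (Finset.card_le_card ?_) (Finset.card_image_le (f := c))
    intro j hj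
    obtain ⟨hji, hj⟩ := Finset.mem_erase.1 hj
    obtain ⟨w, hw, rfl⟩ := Finset.mem_image.1 hj
    exact Finset.mem_image_of_mem _ (by simp [hw, hji])
  rw [Finset.card_erase_of_mem hi] at h2
  omega

/-- A set split into at least `k` classes has few ordered pairs inside the classes. -/
lemma sum_card_fiber_sub_one_le {V κ : Type*} [DecidableEq κ] (T : Finset V) (c : V → κ) {k : ℕ} (hk : k ≤ #(T.image c)) :
    ∑ v ∈ T, ((#{w ∈ T | c w = c v} : ℤ) - 1) ≤ (#T - k + 1) * (#T - k) := by
  have h1 : ∑ v ∈ T, ((#{w ∈ T | c w = c v} : ℤ) - 1) =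
      ∑ i ∈ T.image c, (#{w ∈ T | c w = i} : ℤ) * (#{w ∈ T | c w = i} - 1) := by
    rw [← Finset.sum_fiberwise_of_maps_to (t := T.image c) (g := c)
      fun v hv => Finset.mem_image_of_mem c hv]
    refine Finset.sum_congr rfl fun i _ => ?_
    rw [← nsmul_eq_mul, ← Finset.sum_const]
    refine Finset.sum_congr rfl fun v hv => ?_
    rw [(Finset.mem_filter.1 hv).2]
  have h2 : ∑ i ∈ T.image c, ((#{w ∈ T | c w = i} : ℤ) - 1) = #T - #(T.image c) := by
    rw [Finset.sum_sub_distrib, Finset.sum_const, nsmul_eq_mul, mul_one]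
    congr 1
    exact_mod_cast (Finset.card_eq_sum_card_image c T).symm
  have h3 : #(T.image c) ≤ #T := Finset.card_image_le
  -- Every class has at most #T − #classes + 1 elements, while the numbers (size − 1) add up to #T −
  -- #classes; the extreme case has all classes but one singletons.
  calc _ ≤ ∑ i ∈ T.image c, ((#T : ℤ) - #(T.image c) + 1) * (#{w ∈ T | c w = i} - 1) := by
        rw [h1]
        refine Finset.sum_le_sum fun i hi => ?_
        have h4 := card_image_add_card_fiber_le T c hi
        obtain ⟨w, hw, hwi⟩ := Finset.mem_image.1 hi
        have h5 : 0 < #{w ∈ T | c w = i} := Finset.card_pos.2 ⟨w, by simp [hw, hwi]⟩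
        refine mul_le_mul_of_nonneg_right ?_ ?_ <;> omega
    _ = ((#T : ℤ) - #(T.image c) + 1) * (#T - #(T.image c)) := by rw [← Finset.mul_sum, h2]
    _ ≤ _ := by
        have : (k : ℤ) ≤ #(T.image c) := by exact_mod_cast hk
        have : (#(T.image c) : ℤ) ≤ #T := by exact_mod_cast h3
        gcongr; linarith

variable [Fintype V] [DecidableEq V] [DecidableEq κ] {H : SimpleGraph V} [DecidableRel H.Adj]
  {S : Finset V} {c : V → κ}

lemma SplitBy.degree_add_one_le (h : H.SplitBy S c) {v : V} (hv : v ∉ S) :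
    H.degree v + 1 ≤ #S + #{w ∈ Sᶜ | c w = c v} := by
  rw [← card_neighborFinset_eq_degree, ← Finset.card_insert_of_notMem (a := v) (by simp)]
  refine le_trans (Finset.card_le_card fun w hw => ?_) (Finset.card_union_le _ _)
  by_cases hwS : w ∈ S
  · simp [hwS]
  · rcases Finset.mem_insert.1 hw with rfl | hw
    · simp [hwS]
    · simp [hwS, h w hwS v hv ((H.mem_neighborFinset v w).1 hw).symm]

lemma SplitBy.two_mul_card_edgeFinset_le_sum (h : H.SplitBy S c) :
    (2 * #H.edgeFinset : ℤ) ≤ #S * (Fintype.card V - 1) +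
      ((#S : ℤ) * (Fintype.card V - #S) + ∑ v ∈ Sᶜ, ((#{w ∈ Sᶜ | c w = c v} : ℤ) - 1)) := by
  have h0 : (2 * #H.edgeFinset : ℤ) = ∑ v, (H.degree v : ℤ) := by
    exact_mod_cast H.sum_degrees_eq_twice_card_edges.symm
  have hc : (#Sᶜ : ℤ) = Fintype.card V - #S := by
    rw [Finset.card_compl, Nat.cast_sub (Finset.card_le_univ S)]
  rw [h0, ← Finset.sum_add_sum_compl S, ← hc]
  refine add_le_add ?_ ?_
  · rw [← nsmul_eq_mul]
    refine Finset.sum_le_card_nsmul _ _ _ fun v _ => ?_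
    have := H.degree_lt_card_verts v
    omega
  · rw [mul_comm, ← nsmul_eq_mul, ← Finset.sum_const, ← Finset.sum_add_distrib]
    refine Finset.sum_le_sum fun v hv => ?_
    have := h.degree_add_one_le (Finset.mem_compl.1 hv)
    omega

lemma SplitBy.two_mul_card_edgeFinset_le (h : H.SplitBy S c) {k : ℕ} (hk : k ≤ #(Sᶜ.image c)) :
    (2 * #H.edgeFinset : ℤ) ≤ #S * (Fintype.card V - 1) + #S * (Fintype.card V - #S) +
      (Fintype.card V - #S - k + 1) * (Fintype.card V - #S - k) := by
  have h1 := h.two_mul_card_edgeFinset_le_sum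
  have h2 := sum_card_fiber_sub_one_le Sᶜ c hk
  rw [Finset.card_compl, Nat.cast_sub (Finset.card_le_univ S)] at h2
  linarith

/-- Counting only A against the rest is sharper than counting classes when both parts are large. -/
lemma SplitBy.two_mul_card_edgeFinset_le_of_subset {A : Finset V} (hA : A ⊆ Sᶜ)
    (h : H.SplitBy S (fun v => decide (v ∈ A))) :
    (2 * #H.edgeFinset : ℤ) ≤ #S * (Fintype.card V - 1) + #S * (Fintype.card V - #S) +
      #A * (#A - 1) + (Fintype.card V - #S - #A) * (Fintype.card V - #S - #A - 1) := by
  have h1 := h.two_mul_card_edgeFinset_le_sum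
  have hB : (#(Sᶜ \ A) : ℤ) = Fintype.card V - #S - #A := by
    rw [Finset.card_sdiff_of_subset hA, Nat.cast_sub (Finset.card_le_card hA), Finset.card_compl,
      Nat.cast_sub (Finset.card_le_univ S)]
  rw [← Finset.sum_sdiff hA] at h1
  have e1 : ∑ v ∈ Sᶜ \ A, ((#{w ∈ Sᶜ | decide (w ∈ A) = decide (v ∈ A)} : ℤ) - 1) =
      #(Sᶜ \ A) * (#(Sᶜ \ A) - 1) := by
    rw [← nsmul_eq_mul, ← Finset.sum_const]
    refine Finset.sum_congr rfl fun v hv => ?_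
    have hv' := (Finset.mem_sdiff.1 hv).2
    congr 3
    ext w
    simp [hv']
  have e2 : ∑ v ∈ A, ((#{w ∈ Sᶜ | decide (w ∈ A) = decide (v ∈ A)} : ℤ) - 1) =
      #A * (#A - 1) := by
    rw [← nsmul_eq_mul, ← Finset.sum_const]
    refine Finset.sum_congr rfl fun v hv => ?_
    congr 3
    ext w
    simp only [mem_filter, hv, decide_true, decide_eq_true_eq]
    exact ⟨fun h => h.2, fun h => ⟨hA h, h⟩⟩
  rw [e1, e2, hB] at h1
  linarith

end Splitting

/-! ### Structure of graphs that are not 1-excludable. -/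

section Structure
variable {V : Type*} [Fintype V] [DecidableEq V] {G : SimpleGraph V} [DecidableRel G.Adj]

/-- The graph in which the vertices of `S` are adjacent to everything and `p`, `q` are adjacent. -/
def coneEdge (S : Finset V) (p q : V) : SimpleGraph V where
  Adj x y := x ≠ y ∧ (x ∈ S ∨ y ∈ S ∨ s(x, y) = s(p, q))
  symm := ⟨fun x y h => ⟨h.1.symm, by rw [Sym2.eq_swap]; tauto⟩⟩
  loopless := ⟨fun x h => h.1 rfl⟩

/-- Two cliques, on `T` and on its complement, all of whose vertices are adjacent to `u`. -/
def coneCliques (u : V) (T : Finset V) : SimpleGraph V where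
  Adj x y := x ≠ y ∧ (x = u ∨ y = u ∨ (x ∈ T ↔ y ∈ T))
  symm := ⟨fun x y h => ⟨h.1.symm, by tauto⟩⟩
  loopless := ⟨fun x h => h.1 rfl⟩

instance (S : Finset V) (p q : V) : DecidableRel (coneEdge S p q).Adj :=
  fun x y => inferInstanceAs (Decidable (x ≠ y ∧ (x ∈ S ∨ y ∈ S ∨ s(x, y) = s(p, q))))

instance (u : V) (T : Finset V) : DecidableRel (coneCliques u T).Adj :=
  fun x y => inferInstanceAs (Decidable (x ≠ y ∧ (x = u ∨ y = u ∨ (x ∈ T ↔ y ∈ T))))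

lemma isMatchingFree_deleteEdges {V : Type*} {G : SimpleGraph V} {e : Sym2 V}
    (h : ∀ M : G.Subgraph, M.IsPerfectMatching → e ∈ M.edgeSet) :
    (G.deleteEdges {e}).IsMatchingFree := by
  intro M hM
  have hle : M.spanningCoe ≤ G := M.spanningCoe_le.trans (deleteEdges_le _)
  have h1 := h _ ((Subgraph.IsPerfectMatching.toSubgraph_iff hle).2 hM)
  induction e with | _ x y =>
  have h2 : M.Adj x y := by simpa using h1
  have h3 := h2.adj_sub
  simp at h3

lemma card_edgeFinset_deleteEdges_singleton {p q : V} (h : G.Adj p q) :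
    #(G.deleteEdges {s(p, q)}).edgeFinset + 1 = #G.edgeFinset := by
  have : (G.deleteEdges {s(p, q)}).edgeFinset = G.edgeFinset.erase s(p, q) := by
    ext e
    simp [edgeSet_deleteEdges, and_comm]
  rw [this]
  exact Finset.card_erase_add_one (by simpa using h)

lemma two_mul_card_edgeFinset_coneEdge_le (S : Finset V) {p q : V} (hq : q ∉ S)
    (hn : Fintype.card V = 2 * #S + 2) :
    (2 * #(coneEdge S p q).edgeFinset : ℤ) ≤ #S * (2 * #S + 1) + #S * (#S + 2) + 2 := by
  -- Giving q the colour p leaves at least s + 1 classes on the s + 2 vertices outside S, so only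
  -- one pair can share a class.
  have h : (coneEdge S p q).SplitBy S (fun v => if v = q then p else v) := by
    rintro x hx y hy ⟨-, h⟩
    simp only [hx, hy, false_or, Sym2.eq_iff] at h
    rcases h with ⟨rfl, rfl⟩ | ⟨rfl, rfl⟩ <;> simp
  have hk : #S + 1 ≤ #(Sᶜ.image fun v => if v = q then p else v) := by
    have h1 : #(Sᶜ.erase q) = #S + 1 := by
      rw [Finset.card_erase_of_mem (by simpa using hq), Finset.card_compl]
      omega
    rw [← h1]
    refine Finset.card_le_card fun v hv => ?_
    obtain ⟨hvq, hv⟩ := Finset.mem_erase.1 hv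
    exact Finset.mem_image.2 ⟨v, hv, by simp [hvq]⟩
  have := h.two_mul_card_edgeFinset_le hk
  rw [hn] at this
  push_cast at this
  linarith

lemma two_mul_card_edgeFinset_coneCliques_le {u v w : V} (hv : v ≠ u) (hw : w ≠ u) (hvw : v ≠ w) :
    (2 * #(coneCliques u {v, w}).edgeFinset : ℤ) ≤
      (Fintype.card V : ℤ) ^ 2 - 5 * Fintype.card V + 12 := by
  have h : (coneCliques u {v, w}).SplitBy {u} (fun x => decide (x ∈ ({v, w} : Finset V))) := by
    rintro x hx y hy ⟨-, h⟩
    rw [Finset.mem_singleton] at hx hy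
    simpa only [hx, hy, false_or, decide_eq_decide] using h
  have := h.two_mul_card_edgeFinset_le_of_subset (by
    intro x hx
    rw [Finset.mem_compl, Finset.mem_singleton]
    rcases Finset.mem_insert.1 hx with rfl | hx
    · exact hv
    · rwa [Finset.mem_singleton.1 hx])
  rw [Finset.card_pair hvw, Finset.card_singleton] at this
  push_cast at this
  linarith

/-- The shape of a graph of even order and minimum degree at least two that is not
1-excludable. -/
lemma exists_of_not_isOneExcludable (hV : Even (Fintype.card V)) (hdeg : ∀ v, 2 ≤ G.degree v)
    (hG : ¬ G.IsOneExcludable) :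
    (2 * #G.edgeFinset : ℤ) ≤ (Fintype.card V : ℤ) ^ 2 - 7 * Fintype.card V + 20 ∨
    (7 ≤ Fintype.card V ∧
      (2 * #G.edgeFinset : ℤ) ≤ (Fintype.card V : ℤ) ^ 2 - 7 * Fintype.card V + 26) ∨
    (∃ u v w, v ≠ u ∧ w ≠ u ∧ v ≠ w ∧ G ≤ coneCliques u {v, w}) ∨
    ∃ S : Finset V, 2 ≤ #S ∧ 2 * #S + 2 ≤ Fintype.card V ∧
      (2 * #G.edgeFinset : ℤ) ≤ (Fintype.card V : ℤ) ^ 2 - 3 * Fintype.card V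
        - 2 * Fintype.card V * #S + 3 * #S ^ 2 + 5 * #S + 4 ∧
      (Fintype.card V = 2 * #S + 2 →
        ∃ p q, p ∉ S ∧ q ∉ S ∧ p ≠ q ∧ G ≤ coneEdge S p q) := by
  obtain ⟨e, he, hM⟩ : ∃ e ∈ G.edgeSet, ∀ M : G.Subgraph, M.IsPerfectMatching → e ∈ M.edgeSet := by
    unfold IsOneExcludable at hG
    push Not at hG
    exact hG
  obtain ⟨p, q⟩ := e
  change G.Adj p q at he
  have hpq := he.ne
  obtain ⟨κ, _, S, c, O, hc, hO, hodd⟩ :=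
    exists_splitBy_of_isMatchingFree _ hV (isMatchingFree_deleteEdges hM)
  have hm := card_edgeFinset_deleteEdges_singleton he
  change (G.deleteEdges {s(p, q)}).SplitBy S c at hc
  have hcG : ∀ x ∉ S, ∀ y ∉ S, G.Adj x y → c x = c y ∨ s(x, y) = s(p, q) := by
    intro x hx y hy hxy
    by_cases h : s(x, y) = s(p, q)
    · exact Or.inr h
    · exact Or.inl (hc x hx y hy (by rw [deleteEdges_adj]; exact ⟨hxy, h⟩))
  have hOI : O ⊆ Sᶜ.image c := by
    intro i hi
    obtain ⟨v, hv⟩ := Finset.card_pos.1 (hodd i hi).pos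
    rw [Finset.mem_filter] at hv
    exact Finset.mem_image.2 ⟨v, hv⟩
  have hk : #S + 2 ≤ #(Sᶜ.image c) := hO.trans (Finset.card_le_card hOI)
  have hcompl : #Sᶜ = Fintype.card V - #S := Finset.card_compl S
  have hsn : 2 * #S + 2 ≤ Fintype.card V := by
    have : #(Sᶜ.image c) ≤ #Sᶜ := Finset.card_image_le
    omega
  by_cases hs : 2 ≤ #S
  · refine Or.inr (Or.inr (Or.inr ⟨S, hs, hsn, ?_, fun hn => ?_⟩))
    · have h1 := hc.two_mul_card_edgeFinset_le hk
      push_cast at h1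
      have h2 : (#(G.deleteEdges {s(p, q)}).edgeFinset : ℤ) + 1 = #G.edgeFinset := by
        exact_mod_cast hm
      rw [← h2]
      linarith
    -- There are s + 2 vertices and at least s + 2 classes outside S, so all classes are singletons
    -- and pq is the only possible edge there.
    · have hinj : Set.InjOn c (Sᶜ : Finset V) := by
        rw [← Finset.card_image_iff]
        exact le_antisymm Finset.card_image_le (by omega)
      have hedge : ∀ x ∉ S, ∀ y ∉ S, G.Adj x y → s(x, y) = s(p, q) := by
        intro x hx y hy hxy
        refine (hcG x hx y hy hxy).resolve_left fun h => hxy.ne ?_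
        exact hinj (by simpa using hx) (by simpa using hy) h
      by_cases hpS : p ∉ S ∧ q ∉ S
      · refine ⟨p, q, hpS.1, hpS.2, hpq, fun x y hxy => ⟨hxy.ne, ?_⟩⟩
        by_contra! h
        exact h.2.2 (hedge x h.1 y h.2.1 hxy)
      -- If pq meets S, the complement of S spans no edge and any pair in it will do.
      · obtain ⟨p', hp', q', hq', hpq'⟩ := Finset.one_lt_card.1 (by omega : 1 < #Sᶜ)
        refine ⟨p', q', Finset.mem_compl.1 hp', Finset.mem_compl.1 hq', hpq',
          fun x y hxy => ⟨hxy.ne, ?_⟩⟩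
        by_contra! h
        have := hedge x h.1 y h.2.1 hxy
        rcases Sym2.eq_iff.1 this with ⟨rfl, rfl⟩ | ⟨rfl, rfl⟩
        · exact hpS ⟨h.1, h.2.1⟩
        · exact hpS ⟨h.2.1, h.1⟩
  -- A part with at least three vertices, and at least three vertices outside of it.
  have key : ∀ A ⊆ Sᶜ, (∃ i, A = {v ∈ Sᶜ | c v = i}) → 3 ≤ #A → 3 ≤ #(Sᶜ \ A) →
      (2 * #G.edgeFinset : ℤ) ≤ #S * (Fintype.card V - 1) + #S * (Fintype.card V - #S) + 6 +
        (Fintype.card V - #S - 3) * (Fintype.card V - #S - 4) + 2 := by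
    rintro A hA ⟨i, hi⟩ h1 h2
    have h3 : (G.deleteEdges {s(p, q)}).SplitBy S (fun v => decide (v ∈ A)) := by
      intro x hx y hy hxy
      have := hc x hx y hy hxy
      simp [hi, hx, hy, this]
    have h4 := h3.two_mul_card_edgeFinset_le_of_subset hA
    have h5 : #(Sᶜ \ A) + #A = #Sᶜ := Finset.card_sdiff_add_card_eq_card hA
    have h6 : (#(Sᶜ \ A) : ℤ) = Fintype.card V - #S - #A := by omega
    have h7 : (#(G.deleteEdges {s(p, q)}).edgeFinset : ℤ) + 1 = #G.edgeFinset := by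
      exact_mod_cast hm
    have h8 : (3 : ℤ) ≤ #A := by exact_mod_cast h1
    have h9 : (3 : ℤ) ≤ Fintype.card V - #S - #A := by rw [← h6]; exact_mod_cast h2
    rw [← h7]
    -- By convexity, two parts of fixed total size, each at least 3, span the most edges when one
    -- has size exactly 3.
    nlinarith [mul_nonneg (sub_nonneg.2 h8) (sub_nonneg.2 h9)]
  have key2 : ∀ i ∈ O, ∀ j ∈ O, i ≠ j → #{v ∈ Sᶜ | c v = i} ≠ 1 → #{v ∈ Sᶜ | c v = j} ≠ 1 →
      (2 * #G.edgeFinset : ℤ) ≤ #S * (Fintype.card V - 1) + #S * (Fintype.card V - #S) + 6 +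
        (Fintype.card V - #S - 3) * (Fintype.card V - #S - 4) + 2 ∧
        6 + #S ≤ Fintype.card V := by
    intro i hi j hj hij hi1 hj1
    have h1 : ∀ i ∈ O, #{v ∈ Sᶜ | c v = i} ≠ 1 → 3 ≤ #{v ∈ Sᶜ | c v = i} := by
      intro i hi h
      obtain ⟨k, hk⟩ := hodd i hi
      omega
    have h2 : 3 ≤ #(Sᶜ \ {v ∈ Sᶜ | c v = i}) := by
      refine (h1 j hj hj1).trans (Finset.card_le_card fun v hv => ?_)
      rw [Finset.mem_filter] at hv
      simp only [Finset.mem_sdiff, Finset.mem_filter, hv.1, hv.2, true_and]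
      exact hij.symm
    refine ⟨key _ (Finset.filter_subset _ _) ⟨i, rfl⟩ (h1 i hi hi1) h2, ?_⟩
    have h3 : #(Sᶜ \ {v ∈ Sᶜ | c v = i}) + #{v ∈ Sᶜ | c v = i} = #Sᶜ :=
      Finset.card_sdiff_add_card_eq_card (Finset.filter_subset _ _)
    have := h1 i hi hi1
    omega
  -- A component that is a single vertex contains an end of the edge `pq`.
  have hsing : ∀ i, #{v ∈ Sᶜ | c v = i} = 1 → ∃ v, v ∉ S ∧ {w ∈ Sᶜ | c w = i} = {v} ∧ c v = i ∧
      (v = p ∨ v = q) ∧ S.Nonempty := by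
    intro i hi
    obtain ⟨v, hv⟩ := Finset.card_eq_one.1 hi
    have hv' : v ∈ ({w ∈ Sᶜ | c w = i} : Finset V) := by simp [hv]
    rw [Finset.mem_filter, Finset.mem_compl] at hv'
    have h1 := hc.degree_add_one_le hv'.1
    rw [hv'.2, hi] at h1
    have hne : ∀ w ∈ G.neighborFinset v, w ∉ S → s(v, w) = s(p, q) := by
      intro w hw hwS
      refine (hcG v hv'.1 w hwS (by simpa using hw)).resolve_left fun h => ?_
      have : w ∈ ({w ∈ Sᶜ | c w = i} : Finset V) := by simp [hwS, ← h, hv'.2]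
      rw [hv, Finset.mem_singleton] at this
      simp [this] at hw
    have hnS : ¬ G.neighborFinset v ⊆ S := fun h => by
      have h2 := Finset.card_le_card h
      have := hdeg v
      rw [card_neighborFinset_eq_degree] at h2
      omega
    obtain ⟨w, hw, hwS⟩ := Finset.not_subset.1 hnS
    refine ⟨v, hv'.1, hv, hv'.2, ?_, ?_⟩
    · rcases Sym2.eq_iff.1 (hne w hw hwS) with ⟨h, -⟩ | ⟨h, -⟩ <;> tauto
    · obtain ⟨a, ha, b, hb, hab⟩ := Finset.one_lt_card.1
        (by rw [card_neighborFinset_eq_degree]; exact hdeg v : 1 < #(G.neighborFinset v))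
      by_contra hS
      rw [Finset.not_nonempty_iff_eq_empty] at hS
      have e1 := hne a ha (by simp [hS])
      have e2 := hne b hb (by simp [hS])
      rw [← e2, Sym2.congr_right] at e1
      exact hab e1
  rcases Nat.eq_zero_or_pos #S with hs0 | hs0
  · left
    have hS : S = ∅ := Finset.card_eq_zero.1 hs0
    obtain ⟨i, hi, j, hj, hij⟩ := Finset.one_lt_card.1 (by omega : 1 < #O)
    have h1 : ∀ i, #{v ∈ Sᶜ | c v = i} ≠ 1 := fun i h => by
      obtain ⟨v, -, -, -, -, h⟩ := hsing i h
      simp [hS] at h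
    have := (key2 i hi j hj hij (h1 i) (h1 j)).1
    simp only [hs0] at this
    push_cast at this
    linarith
  · right
    have hs1 : #S = 1 := by omega
    obtain ⟨u, rfl⟩ := Finset.card_eq_one.1 hs1
    have hsplit := Finset.card_filter_add_card_filter_not (s := O)
      (fun i => #{v ∈ ({u} : Finset V)ᶜ | c v = i} = 1)
    -- Two singleton classes must be the two ends of pq, which gives the cone over two cliques.
    -- Otherwise at least two of the three or more odd classes have size at least 3.
    by_cases h2 : 1 < #{i ∈ O | #{v ∈ ({u} : Finset V)ᶜ | c v = i} = 1}
    · right; left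
      obtain ⟨i, hi, j, hj, hij⟩ := Finset.one_lt_card.1 h2
      obtain ⟨v, hv, hvi, hci, hvpq, -⟩ := hsing i (Finset.mem_filter.1 hi).2
      obtain ⟨w, hw, hwj, hcj, hwpq, -⟩ := hsing j (Finset.mem_filter.1 hj).2
      have hvw : v ≠ w := by rintro rfl; exact hij (hci.symm.trans hcj)
      have hvwpq : s(p, q) = s(v, w) := by
        rw [Sym2.eq_iff]
        rcases hvpq with rfl | rfl <;> rcases hwpq with rfl | rfl <;> simp_all
      rw [Finset.mem_singleton] at hv hw
      refine ⟨u, v, w, hv, hw, hvw, fun x y hxy => ⟨hxy.ne, ?_⟩⟩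
      by_cases hx : x = u
      · exact Or.inl hx
      by_cases hy : y = u
      · exact Or.inr (Or.inl hy)
      refine Or.inr (Or.inr ?_)
      have hfib : ∀ x, x ≠ u → (x = v ↔ c x = i) ∧ (x = w ↔ c x = j) := by
        intro x hx
        have h1 : x ∈ ({w ∈ ({u} : Finset V)ᶜ | c w = i} : Finset V) ↔ x = v := by rw [hvi]; simp
        have h2 : x ∈ ({v ∈ ({u} : Finset V)ᶜ | c v = j} : Finset V) ↔ x = w := by rw [hwj]; simp
        simp only [mem_filter, Finset.mem_compl, Finset.mem_singleton, hx, not_false_eq_true,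
          true_and] at h1 h2
        exact ⟨h1.symm, h2.symm⟩
      rcases hcG x (by simpa using hx) y (by simpa using hy) hxy with h | h
      · simp only [Finset.mem_insert, Finset.mem_singleton, (hfib x hx).1, (hfib x hx).2,
          (hfib y hy).1, (hfib y hy).2, h]
      · rw [hvwpq, Sym2.eq_iff] at h
        rcases h with ⟨rfl, rfl⟩ | ⟨rfl, rfl⟩ <;> simp
    · left
      obtain ⟨i, hi, j, hj, hij⟩ := Finset.one_lt_card.1 (by omega :
        1 < #{i ∈ O | ¬ #{v ∈ ({u} : Finset V)ᶜ | c v = i} = 1})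
      rw [Finset.mem_filter] at hi hj
      have := key2 i hi.1 j hj.1 hij hi.2 hj.2
      rw [hs1] at this
      refine ⟨by omega, ?_⟩
      have h := this.1
      push_cast at h
      linarith

end Structure

/-! ### The extremal graphs: failure of 1-excludability and recognition up to isomorphism. -/

section Models
variable {V W : Type*}

/-- A matching cannot saturate a set `T` whose neighbours, except along the edge `pq`, all lie in
a smaller set `S`. -/
lemma not_isOneExcludable_of_iso {G : SimpleGraph V} {H : SimpleGraph W} (φ : G ≃g H)
    {S T : Finset W} (hST : #S < #T) {p q : W} (hpq : H.Adj p q)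
    (h : ∀ x ∈ T, ∀ y, H.Adj x y → y ∈ S ∨ s(x, y) = s(p, q)) : ¬ G.IsOneExcludable := by
  intro hG
  obtain ⟨M, hM, he⟩ := hG s(φ.symm p, φ.symm q) (φ.symm.map_adj_iff.2 hpq)
  rw [Subgraph.isPerfectMatching_iff] at hM
  choose f hf hf' using hM
  have hfadj : ∀ x, H.Adj x (φ (f (φ.symm x))) := fun x => by
    have := φ.map_adj_iff.2 (hf (φ.symm x)).adj_sub
    simpa using this
  refine hST.not_ge (Finset.card_le_card_of_injOn (fun x => φ (f (φ.symm x))) ?_ ?_)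
  · intro x hx
    refine (h x hx _ (hfadj x)).resolve_right fun h' => he ?_
    have h2 : s(φ.symm x, f (φ.symm x)) = s(φ.symm p, φ.symm q) := by
      have := congrArg (Sym2.map φ.symm) h'
      simpa only [Sym2.map_mk, RelIso.symm_apply_apply] using this
    rw [← h2]
    exact hf (φ.symm x)
  · intro x _ y _ hxy
    have h1 : f (φ.symm x) = f (φ.symm y) := φ.injective hxy
    have h2 := hf' _ _ (hf (φ.symm x)).symm
    have h3 := hf' _ _ (h1 ▸ (hf (φ.symm y)).symm : M.Adj (f (φ.symm x)) (φ.symm y))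
    exact φ.symm.injective (h2.trans h3.symm)

lemma not_isOneExcludable_of_iso_cliqueJoinCliqueIsolated {G : SimpleGraph V} {a c : ℕ}
    (hac : a < 2 + c) (φ : G ≃g cliqueJoinCliqueIsolated a 2 c) : ¬ G.IsOneExcludable := by
  -- `S` is K_a and `T` is everything else, which becomes independent once the K_2 edge is
  -- forbidden.
  refine not_isOneExcludable_of_iso φ (S := univ.disjSum ∅) (T := (∅ : Finset _).disjSum univ)
    (p := Sum.inr (Sum.inl 0)) (q := Sum.inr (Sum.inl 1)) ?_ ?_ ?_
  · simpa [Finset.card_disjSum] using hac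
  · simp [cliqueJoinCliqueIsolated, joinWith]
  · rintro (i | i | i) hi (j | j | j) hij <;>
      simp [cliqueJoinCliqueIsolated, joinWith] at hi hij ⊢
    omega

lemma not_isOneExcludable_of_iso_cliqueJoinTwoCliques {G : SimpleGraph V} {c : ℕ}
    (φ : G ≃g cliqueJoinTwoCliques 1 2 c) : ¬ G.IsOneExcludable := by
  -- `T` is the K_2: without its edge, both of its vertices can only be matched to the apex.
  refine not_isOneExcludable_of_iso φ (S := univ.disjSum ∅)
    (T := (∅ : Finset _).disjSum (univ.disjSum ∅))
    (p := Sum.inr (Sum.inl 0)) (q := Sum.inr (Sum.inl 1)) ?_ ?_ ?_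
  · simp
  · simp [cliqueJoinTwoCliques, joinWith]
  · rintro (i | i | i) hi (j | j | j) hij <;>
      simp [cliqueJoinTwoCliques, joinWith] at hi hij ⊢
    all_goals omega

variable [Fintype V] [DecidableEq V]

lemma exists_equiv_of_disjoint {S T : Finset V} (hST : Disjoint S T) {a b c : ℕ} (ha : #S = a)
    (hb : #T = b) (hc : Fintype.card V = a + b + c) :
    ∃ f : Fin a ⊕ (Fin b ⊕ Fin c) ≃ V, (∀ i, f (Sum.inl i) ∈ S) ∧
      (∀ i, f (Sum.inr (Sum.inl i)) ∈ T) ∧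
      ∀ i, f (Sum.inr (Sum.inr i)) ∉ S ∧ f (Sum.inr (Sum.inr i)) ∉ T := by
  have hR : #(S ∪ T)ᶜ = c := by
    rw [Finset.card_compl, Finset.card_union_of_disjoint hST]
    omega
  let eS := (S.equivFinOfCardEq ha).symm
  let eT := (T.equivFinOfCardEq hb).symm
  let eR := ((S ∪ T)ᶜ.equivFinOfCardEq hR).symm
  let f : Fin a ⊕ (Fin b ⊕ Fin c) → V :=
    Sum.elim (fun i => eS i) (Sum.elim (fun i => eT i) (fun i => eR i))
  have hS : ∀ i, (eS i : V) ∈ S := fun i => (eS i).2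
  have hT : ∀ i, (eT i : V) ∈ T := fun i => (eT i).2
  have hR' : ∀ i, (eR i : V) ∉ S ∧ (eR i : V) ∉ T := fun i => by
    simpa [not_or] using (eR i).2
  have hinj : Function.Injective f := by
    refine Function.Injective.sumElim (Subtype.val_injective.comp eS.injective)
      (Function.Injective.sumElim (Subtype.val_injective.comp eT.injective)
        (Subtype.val_injective.comp eR.injective) ?_) ?_
    · exact fun i j h => (hR' j).2 (h ▸ hT i)
    · rintro i (j | j) h
      · exact Finset.disjoint_left.1 hST (hS i) (h ▸ hT j)
      · exact (hR' j).1 ((show (eS i : V) = eR j from h) ▸ hS i)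
  refine ⟨Equiv.ofBijective f ((Fintype.bijective_iff_injective_and_card f).2 ⟨hinj, ?_⟩),
    hS, hT, hR'⟩
  simp [hc, add_assoc]

lemma nonempty_coneEdge_iso {S : Finset V} {p q : V} (hp : p ∉ S) (hq : q ∉ S) (hpq : p ≠ q)
    {a c : ℕ} (ha : #S = a) (hc : Fintype.card V = a + 2 + c) :
    Nonempty (coneEdge S p q ≃g cliqueJoinCliqueIsolated a 2 c) := by
  obtain ⟨f, hS, hT, hR⟩ := exists_equiv_of_disjoint (S := S) (T := {p, q})
    (by simp [hp, hq]) ha (Finset.card_pair hpq) hc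
  have hTS : ∀ i, f (Sum.inr (Sum.inl i)) ∉ S := fun i h => by
    have := hT i
    rw [Finset.mem_insert, Finset.mem_singleton] at this
    rcases this with h' | h'
    · exact hp (h' ▸ h)
    · exact hq (h' ▸ h)
  refine ⟨(RelIso.mk f ?_ : cliqueJoinCliqueIsolated a 2 c ≃g coneEdge S p q).symm⟩
  rintro x y
  have hne : f x ≠ f y ↔ x ≠ y := f.injective.ne_iff
  change (f x ≠ f y ∧ (f x ∈ S ∨ f y ∈ S ∨ s(f x, f y) = s(p, q))) ↔ _
  rw [hne]
  rcases x with i | i | i <;> rcases y with j | j | j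
  · simp [cliqueJoinCliqueIsolated, joinWith, hS]
  · simp [cliqueJoinCliqueIsolated, joinWith, hS]
  · simp [cliqueJoinCliqueIsolated, joinWith, hS]
  · simp [cliqueJoinCliqueIsolated, joinWith, hS]
  · have hi := hT i
    have hj := hT j
    simp only [cliqueJoinCliqueIsolated, joinWith, hTS, Sym2.eq_iff]
    simp only [Finset.mem_insert, Finset.mem_singleton] at hi hj
    simp
    intro hij
    have hne' : f (Sum.inr (Sum.inl i)) ≠ f (Sum.inr (Sum.inl j)) := by simpa using hij
    rcases hi with hi | hi <;> rcases hj with hj | hj <;> simp_all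
  · have hj := (hR j).2
    simp [cliqueJoinCliqueIsolated, joinWith, hTS, (hR j).1] at hj ⊢
    tauto
  · simp [cliqueJoinCliqueIsolated, joinWith, hS]
  · have hi := (hR i).2
    simp [cliqueJoinCliqueIsolated, joinWith, hTS, (hR i).1] at hi ⊢
    tauto
  · have hj : f (Sum.inr (Sum.inr j)) ≠ p ∧ f (Sum.inr (Sum.inr j)) ≠ q := by
      simpa [not_or] using (hR j).2
    simp [cliqueJoinCliqueIsolated, joinWith, hR, hj]

lemma nonempty_coneCliques_iso {u v w : V} (hv : v ≠ u) (hw : w ≠ u) (hvw : v ≠ w)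
    {c : ℕ} (hc : Fintype.card V = 1 + 2 + c) :
    Nonempty (coneCliques u {v, w} ≃g cliqueJoinTwoCliques 1 2 c) := by
  obtain ⟨f, hS, hT, hR⟩ := exists_equiv_of_disjoint (S := {u}) (T := {v, w})
    (by simp [hv.symm, hw.symm]) (Finset.card_singleton u) (Finset.card_pair hvw) hc
  simp only [Finset.mem_singleton] at hS hR
  have hTS : ∀ i, f (Sum.inr (Sum.inl i)) ≠ u := fun i h => by
    have := hT i
    rw [h, Finset.mem_insert, Finset.mem_singleton] at this
    tauto
  refine ⟨(RelIso.mk f ?_ : cliqueJoinTwoCliques 1 2 c ≃g coneCliques u {v, w}).symm⟩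
  rintro x y
  have hne : f x ≠ f y ↔ x ≠ y := f.injective.ne_iff
  change (f x ≠ f y ∧ (f x = u ∨ f y = u ∨
    (f x ∈ ({v, w} : Finset V) ↔ f y ∈ ({v, w} : Finset V)))) ↔ _
  rw [hne]
  rcases x with i | i | i <;> rcases y with j | j | j <;>
    simp only [hS, hT, hTS, hR] <;> simp [cliqueJoinTwoCliques, joinWith]

end Models

/-! ### Lower bounds for the spectral radii of the extremal graphs. -/

section ModelRadius

lemma sum_ite_ne_eq {a : ℕ} (i : Fin a) (t : ℝ) :
    ∑ j, (if i ≠ j then t else 0) = (a - 1) * t := by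
  have : ∀ j, (if i ≠ j then t else 0) = t - if i = j then t else 0 := fun j => by
    by_cases h : i = j <;> simp [h]
  simp only [this, Finset.sum_sub_distrib]
  simp
  ring

open Classical in
lemma sum_neighborFinset_cliqueJoinCliqueIsolated {a b c : ℕ} (α β γ : ℝ) :
    let x : Fin a ⊕ (Fin b ⊕ Fin c) → ℝ := Sum.elim (fun _ => α) (Sum.elim (fun _ => β) fun _ => γ)
    ∀ v, ∑ u ∈ (cliqueJoinCliqueIsolated a b c).neighborFinset v, x u =
      Sum.elim (fun _ => (a - 1) * α + b * β + c * γ)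
        (Sum.elim (fun _ => a * α + (b - 1) * β) fun _ => a * α) v := by
  intro x v
  rw [neighborFinset_eq_filter, Finset.sum_filter, Fintype.sum_sum_type, Fintype.sum_sum_type]
  rcases v with i | i | i
  · have := sum_ite_ne_eq i α
    simp [cliqueJoinCliqueIsolated, joinWith, x] at this ⊢
    linarith
  · have := sum_ite_ne_eq i β
    simp [cliqueJoinCliqueIsolated, joinWith, x] at this ⊢
    linarith
  · simp [cliqueJoinCliqueIsolated, joinWith, x]

open Classical in
lemma sum_neighborFinset_cliqueJoinTwoCliques {a b c : ℕ} (α β γ : ℝ) :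
    let x : Fin a ⊕ (Fin b ⊕ Fin c) → ℝ := Sum.elim (fun _ => α) (Sum.elim (fun _ => β) fun _ => γ)
    ∀ v, ∑ u ∈ (cliqueJoinTwoCliques a b c).neighborFinset v, x u =
      Sum.elim (fun _ => (a - 1) * α + b * β + c * γ)
        (Sum.elim (fun _ => a * α + (b - 1) * β) fun _ => a * α + (c - 1) * γ) v := by
  intro x v
  rw [neighborFinset_eq_filter, Finset.sum_filter, Fintype.sum_sum_type, Fintype.sum_sum_type]
  rcases v with i | i | i
  · have := sum_ite_ne_eq i α
    simp [cliqueJoinTwoCliques, joinWith, x] at this ⊢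
    linarith
  · have := sum_ite_ne_eq i β
    simp [cliqueJoinTwoCliques, joinWith, x] at this ⊢
    linarith
  · have := sum_ite_ne_eq i γ
    simp [cliqueJoinTwoCliques, joinWith, x] at this ⊢
    linarith

lemma le_adjSpectralRadius_two_two_two :
    17 / 5 ≤ (cliqueJoinCliqueIsolated 2 2 2).adjSpectralRadius := by
  classical
  -- With weight 1 on the joined clique, 5/6 and 10/17 make the other two rows tight at 17/5.
  have h := sum_neighborFinset_cliqueJoinCliqueIsolated (a := 2) (b := 2) (c := 2) 1 (5 / 6) (10 / 17)
  refine le_adjSpectralRadius_of_weights _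
    (Sum.elim (fun _ => 1) (Sum.elim (fun _ => 5 / 6) fun _ => 10 / 17)) ?_ ?_
  · rintro (i | i | i) <;> norm_num
  · intro v
    rw [h v]
    rcases v with i | i | i <;> norm_num

lemma le_adjSpectralRadius_three_two_three :
    36 / 7 ≤ (cliqueJoinCliqueIsolated 3 2 3).adjSpectralRadius := by
  classical
  have h := sum_neighborFinset_cliqueJoinCliqueIsolated (a := 3) (b := 2) (c := 3) 36 26 21
  refine le_adjSpectralRadius_of_weights _
    (Sum.elim (fun _ => 36) (Sum.elim (fun _ => 26) fun _ => 21)) ?_ ?_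
  · rintro (i | i | i) <;> norm_num
  · intro v
    rw [h v]
    rcases v with i | i | i <;> norm_num

/-- The graph contains K_{c+1}, of radius c. A small weight t on the K_2 raises the Rayleigh
quotient above c, as the gain 4t beats the loss of order ct²; t = 1/(c+1) is small enough. -/
lemma lt_adjSpectralRadius_cliqueJoinTwoCliques (c : ℕ) :
    (c : ℝ) < (cliqueJoinTwoCliques 1 2 c).adjSpectralRadius := by
  classical
  have h := sum_neighborFinset_cliqueJoinTwoCliques (a := 1) (b := 2) (c := c) 1 (1 / (c + 1)) 1
  have h2 := (cliqueJoinTwoCliques 1 2 c).sum_mul_sum_neighborFinset_le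
    (Sum.elim (fun _ => 1) (Sum.elim (fun _ => 1 / (c + 1)) fun _ => 1))
  simp only [h] at h2
  simp only [Fintype.sum_sum_type, Sum.elim_inl, Sum.elim_inr, Finset.sum_const, Finset.card_univ,
    Fintype.card_fin, nsmul_eq_mul] at h2
  push_cast at h2
  have hc : (0 : ℝ) < c + 1 := by positivity
  by_contra! hle
  have h3 := h2.trans (mul_le_mul_of_nonneg_right hle (by positivity))
  have e : 1 / ((c : ℝ) + 1) * (c + 1) = 1 := by field_simp
  set t := 1 / ((c : ℝ) + 1)
  have ht : 0 < t := by positivity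
  nlinarith

end ModelRadius

/-! ### Comparing edge counts and radii for each order. -/

section Extremal

lemma eq_of_le_of_two_mul_card_edgeFinset_le {V : Type*} [Fintype V] {G : SimpleGraph V}
    [DecidableRel G.Adj] {H : SimpleGraph V} [DecidableRel H.Adj] (h : G ≤ H)
    (hc : (2 * #H.edgeFinset : ℤ) ≤ 2 * #G.edgeFinset) : G = H :=
  edgeFinset_inj.1 (Finset.eq_of_subset_of_card_le (edgeFinset_mono h) (by omega))

lemma sum_neighborFinset_le_of_subset {V : Type*} [Fintype V] {G : SimpleGraph V}
    [DecidableRel G.Adj] {x : V → ℝ} (hx : ∀ v, 0 < x v) {v : V} {T : Finset V}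
    (h : ∀ u, G.Adj v u → u ∈ T) : ∑ u ∈ G.neighborFinset v, x u ≤ ∑ u ∈ T, x u :=
  Finset.sum_le_sum_of_subset_of_nonneg (fun u hu => h u ((G.mem_neighborFinset v u).1 hu))
    fun u _ _ => (hx u).le

variable {V : Type*} [Fintype V] [DecidableEq V] {G : SimpleGraph V} [DecidableRel G.Adj]

/-- For n = 8 this competitor can have 18 edges, which edge counting does not exclude; but 51/10 <
36/7. -/
lemma adjSpectralRadius_le_of_le_coneCliques {u v w : V} (hv : v ≠ u) (hw : w ≠ u) (hvw : v ≠ w)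
    (hV : Fintype.card V = 8) (h : G ≤ coneCliques u {v, w}) : G.adjSpectralRadius ≤ 51 / 10 := by
  have : Nonempty V := ⟨u⟩
  let x : V → ℝ := fun y => if y = u then 1 else if y ∈ ({v, w} : Finset V) then 1 / 4 else 10 / 11
  have hx : ∀ y, 0 < x y := fun y => by simp only [x]; split_ifs <;> norm_num
  have xu : x u = 1 := by simp [x]
  have xv : x v = 1 / 4 := by simp [x, hv]
  have xw : x w = 1 / 4 := by simp [x, hw]
  have hxr : ∀ y ∈ ({u, v, w} : Finset V)ᶜ, x y = 10 / 11 := fun y hy => by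
    simp only [Finset.mem_compl, Finset.mem_insert, Finset.mem_singleton, not_or] at hy
    simp [x, hy]
  have hcard : #({u, v, w} : Finset V)ᶜ = 5 := by
    rw [Finset.card_compl, hV, Finset.card_eq_three.2 ⟨u, v, w, hv.symm, hw.symm, hvw, rfl⟩]
  have hsumR : ∑ y ∈ ({u, v, w} : Finset V)ᶜ, x y = 50 / 11 := by
    rw [Finset.sum_congr rfl hxr, Finset.sum_const, hcard]
    norm_num
  refine G.adjSpectralRadius_le_of_weights x hx fun y => ?_
  by_cases hyu : y = u
  · subst hyu
    refine (sum_neighborFinset_le_of_subset hx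
      (T := insert v (insert w ({y, v, w} : Finset V)ᶜ)) fun z hz => ?_).trans ?_
    · have := hz.ne
      simp only [Finset.mem_insert, Finset.mem_compl, Finset.mem_singleton]
      tauto
    · rw [Finset.sum_insert (by simp [hvw]), Finset.sum_insert (by simp), hsumR, xv, xw, xu]
      norm_num
  by_cases hyv : y = v
  · subst hyv
    refine (sum_neighborFinset_le_of_subset hx (T := {u, w}) fun z hz => ?_).trans ?_
    · have := (h hz).2
      have := hz.ne
      simp only [Finset.mem_insert, Finset.mem_singleton] at *
      tauto
    · rw [Finset.sum_pair hw.symm, xu, xw, xv]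
      norm_num
  by_cases hyw : y = w
  · subst hyw
    refine (sum_neighborFinset_le_of_subset hx (T := {u, v}) fun z hz => ?_).trans ?_
    · have := (h hz).2
      have := hz.ne
      simp only [Finset.mem_insert, Finset.mem_singleton] at *
      tauto
    · rw [Finset.sum_pair hv.symm, xu, xw, xv]
      norm_num
  · have hy : y ∈ ({u, v, w} : Finset V)ᶜ := by simp [hyu, hyv, hyw]
    refine (sum_neighborFinset_le_of_subset hx
      (T := insert u (({u, v, w} : Finset V)ᶜ.erase y)) fun z hz => ?_).trans ?_
    · have := (h hz).2
      have := hz.ne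
      simp only [Finset.mem_insert, Finset.mem_singleton, Finset.mem_erase, Finset.mem_compl] at *
      tauto
    · have := Finset.add_sum_erase _ x hy
      rw [hxr y hy, hsumR] at this
      rw [Finset.sum_insert (by simp), xu, hxr y hy]
      linarith

/-- K_4 ∨ (K_2 ∪ 4K_1) has 31 edges, exactly as many as K_1 ∨ (K_2 ∪ K_7), so only the radius
separates them. The weights 1 and 2/3 are tight at 7 on S and on the pair p, q. -/
lemma adjSpectralRadius_le_of_le_coneEdge {S : Finset V} {p q : V} (hp : p ∉ S) (hq : q ∉ S)
    (hS : #S = 4) (hV : Fintype.card V = 10) (h : G ≤ coneEdge S p q) :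
    G.adjSpectralRadius ≤ 7 := by
  have : Nonempty V := ⟨p⟩
  let x : V → ℝ := fun y => if y ∈ S then 1 else 2 / 3
  have hx : ∀ y, 0 < x y := fun y => by simp only [x]; split_ifs <;> norm_num
  have hxS : ∀ y ∈ S, x y = 1 := fun y hy => by simp [x, hy]
  have hxS' : ∀ y ∉ S, x y = 2 / 3 := fun y hy => by simp [x, hy]
  have hsumS : ∑ y ∈ S, x y = 4 := by
    rw [Finset.sum_congr rfl hxS]
    simp [hS]
  have hsumS' : ∑ y ∈ Sᶜ, x y = 4 := by
    rw [Finset.sum_congr rfl fun y hy => hxS' y (Finset.mem_compl.1 hy), Finset.sum_const,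
      Finset.card_compl, hV, hS]
    norm_num
  have hsum : ∑ y, x y = 8 := by
    rw [← Finset.sum_add_sum_compl S, hsumS, hsumS']
    norm_num
  have hout : ∀ y ∉ S, ∀ r ∉ S, (∀ z, G.Adj y z → z ∈ insert r S) →
      ∑ z ∈ G.neighborFinset y, x z ≤ 7 * x y := by
    intro y hy r hr hsub
    refine (sum_neighborFinset_le_of_subset hx hsub).trans ?_
    rw [Finset.sum_insert hr, hsumS, hxS' y hy, hxS' r hr]
    norm_num
  refine G.adjSpectralRadius_le_of_weights x hx fun y => ?_
  by_cases hy : y ∈ S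
  · refine (sum_neighborFinset_le_of_subset hx (T := univ.erase y) fun z hz => ?_).trans ?_
    · simp [hz.ne.symm]
    · have := Finset.add_sum_erase _ x (mem_univ y)
      rw [hsum, hxS y hy] at this
      rw [hxS y hy]
      linarith
  · by_cases hyp : y = p
    · refine hout y hy q hq fun z hz => ?_
      have h1 := (h hz).2
      have h2 := hz.ne
      rw [Sym2.eq_iff] at h1
      rw [Finset.mem_insert]
      rcases h1 with h1 | h1 | ⟨-, h1⟩ | ⟨h1, h3⟩
      · exact absurd h1 hy
      · exact Or.inr h1
      · exact Or.inl h1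
      · exact absurd (hyp.trans h3.symm) h2
    · refine hout y hy p hp fun z hz => ?_
      have h1 := (h hz).2
      rw [Sym2.eq_iff] at h1
      rw [Finset.mem_insert]
      tauto

/-- Removing at most one edge from the cone lowers at most one degree below `#S`. -/
lemma exists_forall_ne_three_le_degree {S : Finset V} {p q : V} (hS : #S = 3)
    (hV : Fintype.card V = 8) (h : G ≤ coneEdge S p q)
    (hc : #(coneEdge S p q).edgeFinset ≤ #G.edgeFinset + 1) :
    ∃ b, ∀ v, v ≠ b → 3 ≤ G.degree v := by
  obtain ⟨f, hf⟩ : ∃ f, ∀ x y, (coneEdge S p q).Adj x y → s(x, y) ≠ f → G.Adj x y := by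
    have h1 : #((coneEdge S p q).edgeFinset \ G.edgeFinset) ≤ 1 := by
      rw [Finset.card_sdiff_of_subset (edgeFinset_mono h)]
      omega
    have : Nonempty (Sym2 V) := ⟨s(p, p)⟩
    obtain ⟨f, hf⟩ := Finset.card_le_one_iff_subset_singleton.1 h1
    refine ⟨f, fun x y hxy hne => ?_⟩
    by_contra hG
    exact hne (Finset.mem_singleton.1 (hf (by simp [hxy, hG])))
  obtain ⟨a, b⟩ := f
  change ∀ x y, _ → s(x, y) ≠ s(a, b) → _ at hf
  -- Only one end of the missing edge ab can lose a neighbour in S while lying outside S.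
  obtain ⟨d, hd⟩ : ∃ d, ∀ u ∉ S, u ≠ d → ∀ x ∈ S, s(u, x) ≠ s(a, b) := by
    by_cases ha : a ∈ S
    · refine ⟨b, fun u hu hub x hx he => ?_⟩
      rcases Sym2.eq_iff.1 he with ⟨rfl, -⟩ | ⟨h, -⟩
      exacts [hu ha, hub h]
    · refine ⟨a, fun u hu hua x hx he => ?_⟩
      rcases Sym2.eq_iff.1 he with ⟨h, -⟩ | ⟨-, rfl⟩
      exacts [hua h, ha hx]
  refine ⟨d, fun v hv => ?_⟩
  rw [← card_neighborFinset_eq_degree]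
  by_cases hvS : v ∈ S
  · have h1 : ({v, a, b} : Finset V)ᶜ ⊆ G.neighborFinset v := by
      intro y hy
      simp only [Finset.mem_compl, Finset.mem_insert, Finset.mem_singleton, not_or] at hy
      rw [mem_neighborFinset]
      refine hf v y ⟨Ne.symm hy.1, Or.inl hvS⟩ fun he => ?_
      rw [Sym2.eq_iff] at he
      tauto
    have h2 := Finset.card_le_card h1
    have h3 : #({v, a, b} : Finset V) ≤ 3 := Finset.card_le_three
    rw [Finset.card_compl] at h2
    omega
  · rw [← hS]
    refine Finset.card_le_card fun y hy => ?_
    rw [mem_neighborFinset]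
    exact hf v y ⟨by rintro rfl; exact hvS hy, Or.inr (Or.inl hy)⟩ (hd v hvS hv y hy)

/-- This treats the extremal graph for n = 8 with one edge removed. Minimum degree 2 gives too weak
a bound; using d = 3 with total deficit 1 gives 36 − 21 + 1 = 16, below (36/7)(22/7). -/
lemma adjSpectralRadius_sq_sub_two_mul_le_of_le_coneEdge {S : Finset V} {p q : V} (hS : #S = 3)
    (hV : Fintype.card V = 8) (hdeg : ∀ v, 2 ≤ G.degree v) (h : G ≤ coneEdge S p q)
    (hG : #G.edgeFinset = 18) (hc : #(coneEdge S p q).edgeFinset ≤ 19) :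
    G.adjSpectralRadius ^ 2 - 2 * G.adjSpectralRadius ≤ 16 := by
  have : Nonempty V := ⟨p⟩
  obtain ⟨b, hb⟩ := exists_forall_ne_three_le_degree hS hV h (by omega)
  refine G.adjSpectralRadius_sq_sub_le fun v => ?_
  have := G.sum_neighborFinset_degree_le (d := 3) (t := 1) v (by
    set X := univ \ insert v (G.neighborFinset v)
    have h1 : ∑ u ∈ X, 3 ≤ ∑ u ∈ X, (G.degree u + if u = b then 1 else 0) := by
      refine Finset.sum_le_sum fun u _ => ?_
      split_ifs with hu
      · have := hdeg u
        omega
      · exact hb u hu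
    have h2 : ∑ u ∈ X, (if u = b then 1 else 0) ≤ 1 := by
      rw [Finset.sum_ite_eq']
      split_ifs <;> simp
    rw [Finset.sum_add_distrib, Finset.sum_const, smul_eq_mul] at h1
    omega)
  rw [hG, hV] at this
  norm_num at this
  linarith

lemma nonempty_iso_of_card_eq_six (hV : Fintype.card V = 6) (hdeg : ∀ v, 2 ≤ G.degree v)
    (hG : ¬ G.IsOneExcludable)
    (hρ : (cliqueJoinCliqueIsolated 2 2 2).adjSpectralRadius ≤ G.adjSpectralRadius) :
    Nonempty (G ≃g cliqueJoinCliqueIsolated 2 2 2) := by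
  have hne : Nonempty V := Fintype.card_pos_iff.1 (by omega)
  have h1 := le_adjSpectralRadius_two_two_two.trans hρ
  have h2 := G.adjSpectralRadius_sq_sub_le_of_minDegree hdeg
  -- Nine edges would give ρ² − ρ ≤ 8, but (17/5)(12/5) > 8.
  have hm : 10 ≤ #G.edgeFinset := by
    by_contra! hlt
    have h3 : (#G.edgeFinset : ℝ) ≤ 9 := by exact_mod_cast Nat.le_of_lt_succ hlt
    rw [hV] at h2
    push_cast at h2
    nlinarith
  rcases exists_of_not_isOneExcludable (by rw [hV]; decide) hdeg hG with
    h | ⟨h, -⟩ | ⟨u, v, w, hv, hw, hvw, h⟩ | ⟨S, hS, hsn, -, h⟩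
  · rw [hV] at h
    push_cast at h
    omega
  · omega
  · have h3 := two_mul_card_edgeFinset_coneCliques_le hv hw hvw
    have h4 := Finset.card_le_card (edgeFinset_mono h)
    rw [hV] at h3
    push_cast at h3
    omega
  · have hS' : #S = 2 := by omega
    obtain ⟨p, q, hp, hq, hpq, h⟩ := h (by omega)
    have h3 := two_mul_card_edgeFinset_coneEdge_le S (p := p) hq (by omega)
    rw [hS'] at h3
    push_cast at h3
    obtain rfl := eq_of_le_of_two_mul_card_edgeFinset_le h (by omega)
    exact nonempty_coneEdge_iso hp hq hpq hS' hV

lemma nonempty_iso_of_card_eq_eight (hV : Fintype.card V = 8) (hdeg : ∀ v, 2 ≤ G.degree v)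
    (hG : ¬ G.IsOneExcludable)
    (hρ : (cliqueJoinCliqueIsolated 3 2 3).adjSpectralRadius ≤ G.adjSpectralRadius) :
    Nonempty (G ≃g cliqueJoinCliqueIsolated 3 2 3) := by
  have hne : Nonempty V := Fintype.card_pos_iff.1 (by omega)
  have h1 := le_adjSpectralRadius_three_two_three.trans hρ
  have h2 := G.adjSpectralRadius_sq_sub_le_of_minDegree hdeg
  -- Seventeen edges would give ρ² − ρ ≤ 20, but (36/7)(29/7) > 20.
  have hm : 18 ≤ #G.edgeFinset := by
    by_contra! hlt
    have h3 : (#G.edgeFinset : ℝ) ≤ 17 := by exact_mod_cast Nat.le_of_lt_succ hlt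
    rw [hV] at h2
    push_cast at h2
    nlinarith
  rcases exists_of_not_isOneExcludable (by rw [hV]; decide) hdeg hG with
    h | ⟨-, h⟩ | ⟨u, v, w, hv, hw, hvw, h⟩ | ⟨S, hS, hsn, h', h⟩
  · rw [hV] at h
    push_cast at h
    omega
  · rw [hV] at h
    push_cast at h
    omega
  · have h3 := adjSpectralRadius_le_of_le_coneCliques hv hw hvw hV h
    linarith
  · rw [hV] at h'
    push_cast at h'
    have hS' : #S = 3 := by
      rcases (by omega : #S = 2 ∨ #S = 3) with hS' | hS'
      · rw [hS'] at h'
        push_cast at h'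
        omega
      · exact hS'
    obtain ⟨p, q, hp, hq, hpq, h⟩ := h (by omega)
    have h3 := two_mul_card_edgeFinset_coneEdge_le S (p := p) hq (by omega)
    rw [hS'] at h3
    push_cast at h3
    by_cases hm' : #G.edgeFinset = 18
    · have := adjSpectralRadius_sq_sub_two_mul_le_of_le_coneEdge hS' hV hdeg h hm' (by omega)
      nlinarith
    · obtain rfl := eq_of_le_of_two_mul_card_edgeFinset_le h (by omega)
      exact nonempty_coneEdge_iso hp hq hpq hS' hV

lemma nonempty_iso_of_ten_le_card (hV : 10 ≤ Fintype.card V) (hV' : Even (Fintype.card V))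
    (hdeg : ∀ v, 2 ≤ G.degree v) (hG : ¬ G.IsOneExcludable)
    (hρ : (cliqueJoinTwoCliques 1 2 (Fintype.card V - 3)).adjSpectralRadius ≤
      G.adjSpectralRadius) :
    Nonempty (G ≃g cliqueJoinTwoCliques 1 2 (Fintype.card V - 3)) := by
  have hne : Nonempty V := Fintype.card_pos_iff.1 (by omega)
  have h1 := (lt_adjSpectralRadius_cliqueJoinTwoCliques _).trans_le hρ
  have h2 := G.adjSpectralRadius_sq_sub_le_of_minDegree hdeg
  rw [Nat.cast_sub (by omega)] at h1
  have hVZ : (10 : ℤ) ≤ Fintype.card V := by exact_mod_cast hV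
  -- From ρ > n − 3, 2m exceeds (n−3)(n−4) + 2(n−1) = n² − 5n + 10. Both sides are even, so it
  -- reaches n² − 5n + 12, twice the edge count of the extremal graph.
  have hm : (Fintype.card V : ℤ) ^ 2 - 5 * Fintype.card V + 12 ≤ 2 * #G.edgeFinset := by
    have h3 : (Fintype.card V : ℝ) ^ 2 - 5 * Fintype.card V + 10 < 2 * #G.edgeFinset := by
      have h4 : (10 : ℝ) ≤ Fintype.card V := by exact_mod_cast hV
      push_cast at h1 h2
      nlinarith
    have h5 : (Fintype.card V : ℤ) ^ 2 - 5 * Fintype.card V + 10 < 2 * #G.edgeFinset := by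
      exact_mod_cast h3
    obtain ⟨k, hk⟩ := hV'
    have hk' : (Fintype.card V : ℤ) = 2 * k := by omega
    rw [hk'] at h5 ⊢
    have e : (2 * (k : ℤ)) ^ 2 = 2 * (2 * k ^ 2) := by ring
    rw [e] at h5 ⊢
    omega
  rcases exists_of_not_isOneExcludable hV' hdeg hG with
    h | ⟨-, h⟩ | ⟨u, v, w, hv, hw, hvw, h⟩ | ⟨S, hS, hsn, h', h⟩
  · linarith
  · linarith
  · obtain rfl := eq_of_le_of_two_mul_card_edgeFinset_le h
      ((two_mul_card_edgeFinset_coneCliques_le hv hw hvw).trans hm)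
    exact nonempty_coneCliques_iso hv hw hvw (by omega)
  · exfalso
    -- The two edge bounds combine to (s − 1)(2n − 3s − 8) ≤ 0. With 2s + 2 ≤ n and n ≥ 10 this
    -- leaves only n = 10, s = 4.
    have hle : 2 * (Fintype.card V : ℤ) ≤ 3 * #S + 8 := by
      have hS2 : (2 : ℤ) ≤ #S := by exact_mod_cast hS
      by_contra! hlt
      nlinarith
    have hV10 : Fintype.card V = 10 := by omega
    have hS4 : #S = 4 := by omega
    obtain ⟨p, q, hp, hq, -, h⟩ := h (by omega)
    have := adjSpectralRadius_le_of_le_coneEdge hp hq hS4 hV10 h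
    rw [hV10] at h1
    norm_num at h1
    linarith

end Extremal

end SimpleGraph

theorem theorem1p6 {V : Type*} [Fintype V] (G : SimpleGraph V) [DecidableRel G.Adj]
    (n : ℕ) (hn : Even n) (hcard : Fintype.card V = n) (hconn : G.Connected)
    (hdeg : 2 ≤ G.minDegree) :
    (n = 6 →
      (cliqueJoinCliqueIsolated 2 2 2).adjSpectralRadius ≤ G.adjSpectralRadius →
      (G.IsOneExcludable ↔ ¬ Nonempty (G ≃g cliqueJoinCliqueIsolated 2 2 2))) ∧
    (n = 8 →
      (cliqueJoinCliqueIsolated 3 2 3).adjSpectralRadius ≤ G.adjSpectralRadius →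
      (G.IsOneExcludable ↔ ¬ Nonempty (G ≃g cliqueJoinCliqueIsolated 3 2 3))) ∧
    (10 ≤ n →
      (cliqueJoinTwoCliques 1 2 (n - 3)).adjSpectralRadius ≤ G.adjSpectralRadius →
      (G.IsOneExcludable ↔ ¬ Nonempty (G ≃g cliqueJoinTwoCliques 1 2 (n - 3)))) := by
  classical
  subst hcard
  have hdeg' : ∀ v, 2 ≤ G.degree v := fun v => hdeg.trans (G.minDegree_le_degree v)
  refine ⟨fun h6 hρ => ⟨?_, ?_⟩, fun h8 hρ => ⟨?_, ?_⟩, fun h10 hρ => ⟨?_, ?_⟩⟩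
  · rintro hG ⟨φ⟩
    exact SimpleGraph.not_isOneExcludable_of_iso_cliqueJoinCliqueIsolated (by omega) φ hG
  · contrapose!
    exact fun hG => SimpleGraph.nonempty_iso_of_card_eq_six h6 hdeg' hG hρ
  · rintro hG ⟨φ⟩
    exact SimpleGraph.not_isOneExcludable_of_iso_cliqueJoinCliqueIsolated (by omega) φ hG
  · contrapose!
    exact fun hG => SimpleGraph.nonempty_iso_of_card_eq_eight h8 hdeg' hG hρ
  · rintro hG ⟨φ⟩
    exact SimpleGraph.not_isOneExcludable_of_iso_cliqueJoinTwoCliques φ hG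
  · contrapose!
    exact fun hG => SimpleGraph.nonempty_iso_of_ten_le_card h10 hn hdeg' hG hρ
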